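/- Consider $N$ sporadic tasks $\tau_1,\dots,\tau_N$, where $\tau_i$ has worst-case execution time $C_i>0$, relative deadline $D_i>0$ and minimum inter-arrival time $T_i>0$, with $C_i\le D_i$ and utilization $U_i=C_i/T_i\le 1$ (no relation between $D_i$ and $T_i$ is assumed). Each $\tau_i$ releases a sequence of jobs whose consecutive arrivals are at least $T_i$ apart; each job of $\tau_i$ needs at most $C_i$ units of execution and has its absolute deadline $D_i$ time units after its arrival. The jobs are executed on $M\ge 2$ identical unit-speed processors under preemptive global fixed-priority scheduling, where $\tau_i$ has higher priority than $\tau_j$ if $i<j$: at every instant the $M$ highest-priority tasks with unfinished jobs (all such tasks, if there are at most $M$) are executed; at any instant a task executes at most one job, on at most one processor; and the jobs of a task are executed in order of arrival. Let $1\le k\le N$, let $\delta_k=C_k/\min\{D_k,T_k\}$ and $$U^{\max}_{\delta,k}=\max\Big\{\max_{1\le i<k}U_i,\ \delta_k\Big\}$$ (which is $\delta_k$ if $k=1$). Suppose that for every integer $\ell\ge 1$, with $D_k'=(\ell-1)T_k+D_k$, $$\frac{\ell C_k}{D_k'}+\sum_{i=1}^{k-1}\left(\frac{C_i-C_iU_i}{D_k'}+U_i\right)\le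 M-(M-1)\,U^{\max}_{\delta,k}.$$ Then $\tau_k$ is schedulable: for every legal sequence of jobs of the tasks and every resulting schedule, every job of $\tau_k$ finishes no later than its absolute deadline. -/

import Mathlib

open MeasureTheory

namespace GlobalFP

/-- A sporadic real-time task: worst-case execution time `C`, relative deadline `D`,
minimum inter-arrival time (period) `T`. -/
structure Task where
  C : ℝ
  D : ℝ
  T : ℝ

namespace Task

/-- Utilization. -/
noncomputable def U (τ : Task) : ℝ := τ.C / τ.T

/-- Density. -/
noncomputable def density (τ : Task) : ℝ := τ.C / min τ.D τ.T

/-- The standing assumptions on a single (arbitrary-deadline) task: positive parameters,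
`C / D ≤ 1` and utilization at most one. No relation between `D` and `T` is imposed. -/
structure Admissible (τ : Task) : Prop where
  C_pos : 0 < τ.C
  D_pos : 0 < τ.D
  T_pos : 0 < τ.T
  C_div_D_le_one : τ.C / τ.D ≤ 1
  U_le_one : τ.U ≤ 1

end Task

/-- The maximum of the utilizations of the tasks of higher priority than task `k`
and of the density of task `k`: `max (max_{i < k} U_i) δ_k`. -/
noncomputable def Umax {N : ℕ} (τ : Fin N → Task) (k : Fin N) : ℝ :=
  (Finset.Iio k).fold max (τ k).density (fun i => (τ i).U)

/-- A legal behaviour of the task set: the `j`-th job of task `i` arrives at `arrival i j` and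
needs `exec i j ≤ C_i` units of execution; consecutive arrivals of task `i` are at least `T_i`
apart. -/
structure JobSequence {N : ℕ} (τ : Fin N → Task) where
  arrival : Fin N → ℕ → ℝ
  exec : Fin N → ℕ → ℝ
  arrival_add_period_le : ∀ i j, arrival i j + (τ i).T ≤ arrival i (j + 1)
  exec_nonneg : ∀ i j, 0 ≤ exec i j
  exec_le : ∀ i j, exec i j ≤ (τ i).C

/-- An assignment of `M` identical unit-speed processors over time: `S p t = some (i, j)` means
that processor `p` executes the `j`-th job of task `i` at time `t`, and `S p t = none` that it
idles. -/
abbrev Assignment (M N : ℕ) := Fin M → ℝ → Option (Fin N × ℕ)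

/-- The instants at which the `j`-th job of task `i` is executed on some processor. -/
def executionSet {M N : ℕ} (S : Assignment M N) (i : Fin N) (j : ℕ) : Set ℝ :=
  {t | ∃ p, S p t = some (i, j)}

section

variable {M N : ℕ} {τ : Fin N → Task}

/-- The amount of execution that the `j`-th job of task `i` receives from its arrival until
time `t`. -/
noncomputable def service (ω : JobSequence τ) (S : Assignment M N)
    (i : Fin N) (j : ℕ) (t : ℝ) : ℝ :=
  volume.real (executionSet S i j ∩ Set.Ico (ω.arrival i j) t)

/-- The `j`-th job of task `i` has arrived before or at `t` and has not finished at `t`. -/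
def Pending (ω : JobSequence τ) (S : Assignment M N) (i : Fin N) (j : ℕ) (t : ℝ) : Prop :=
  ω.arrival i j ≤ t ∧ service ω S i j t < ω.exec i j

/-- Task `i` is active at `t`: it has a pending job. -/
def Active (ω : JobSequence τ) (S : Assignment M N) (i : Fin N) (t : ℝ) : Prop :=
  ∃ j, Pending ω S i j t

/-- `S` is a schedule of the jobs `ω` under preemptive global fixed-priority scheduling, where
task `i` has higher priority than task `i'` if `i < i'`. -/
structure IsGlobalFPSchedule (ω : JobSequence τ) (S : Assignment M N) : Prop where
  measurableSet_executionSet : ∀ i j, MeasurableSet (executionSet S i j)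
  /-- Only pending jobs are executed. -/
  pending : ∀ p t i j, S p t = some (i, j) → Pending ω S i j t
  /-- The jobs of one task are executed in the order of their arrival. -/
  fifo : ∀ p t i j, S p t = some (i, j) → ∀ j' < j, ¬ Pending ω S i j' t
  /-- No intra-task parallelism: at any instant a task occupies at most one processor. -/
  sequential : ∀ p q t i j j', S p t = some (i, j) → S q t = some (i, j') → p = q
  /-- Work-conserving with priorities: an active task that is not being executed is blocked, that
  is, every processor is executing a job of a task of higher priority. -/
  priority : ∀ i t, Active ω S i t → (∀ p j, S p t ≠ some (i, j)) →
    ∀ p, ∃ i' < i, ∃ j', S p t = some (i', j')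

end

/-- Task `k` is schedulable on `M` processors under global fixed-priority scheduling: for every
legal job sequence and every resulting schedule, each job of task `k` is completed by its absolute
deadline, i.e. its response time is at most `D_k`. -/
def Schedulable {N : ℕ} (M : ℕ) (τ : Fin N → Task) (k : Fin N) : Prop :=
  ∀ (ω : JobSequence τ) (S : Assignment M N), IsGlobalFPSchedule ω S →
    ∀ j, ω.exec k j ≤ service ω S k j (ω.arrival k j + (τ k).D)

end GlobalFP

namespace GlobalFP

/-! Put `μ = M - (M - 1) * Umax τ k`. A miss at `d` yields a busy period `[a, d)` of task `k` with
execution `X < ℓ * C_k` and `d - a ≥ D'` (`exists_busy_period_of_deadline_miss`). Whenever `k`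
waits, `M` higher-priority tasks run, so their work is at least `M * (d - a - X)`
(`interference_le`); as `X ≤ Umax * (d - a)`, it exceeds `μ * (d - a) - ℓ * C_k`. Carry-in at `a`
could spoil an upper bound on this work. So the window is extended left to a point `t` maximizing
work minus `μ` times length (`exists_extended_window`). If task `i < k` has been active since `b <
t`, maximality makes the load on `[b, t)` at most `μ * (t - b)`, which forces `i` to run there at
rate at least `Umax ≥ U_i`. Subtracting this from the carry-in-free bound on `[b, d)` leaves the
same linear bound on `[t, d)`. Summing over `i < k` contradicts the test, since `d - t ≥ D'`. -/

/-- The time that the set `A` occupies in `[s, t)`. -/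
noncomputable def occupancy (A : Set ℝ) (s t : ℝ) : ℝ := volume.real (A ∩ Set.Ico s t)

lemma occupancy_nonneg (A : Set ℝ) (s t : ℝ) : 0 ≤ occupancy A s t := measureReal_nonneg

lemma volume_inter_Ico_ne_top (A : Set ℝ) (s t : ℝ) : volume (A ∩ Set.Ico s t) ≠ ⊤ :=
  measure_ne_top_of_subset Set.inter_subset_right (by simp)

lemma occupancy_mono {A B : Set ℝ} {s t u v : ℝ}
    (h : A ∩ Set.Ico s t ⊆ B ∩ Set.Ico u v) : occupancy A s t ≤ occupancy B u v :=
  measureReal_mono h (volume_inter_Ico_ne_top B u v)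

lemma occupancy_le_sub (A : Set ℝ) {s t : ℝ} (h : s ≤ t) : occupancy A s t ≤ t - s := by
  have := measureReal_mono (μ := volume) (Set.inter_subset_right : A ∩ Set.Ico s t ⊆ _)
    (by simp)
  simpa [occupancy, Real.volume_real_Ico_of_le h] using this

lemma occupancy_self (A : Set ℝ) (s : ℝ) : occupancy A s s = 0 := by simp [occupancy]

lemma occupancy_mono_right (A : Set ℝ) (s : ℝ) : Monotone (occupancy A s) := fun _ _ h =>
  occupancy_mono (Set.inter_subset_inter_right _ (Set.Ico_subset_Ico_right h))

lemma occupancy_add (A : Set ℝ) {s t u : ℝ} (hst : s ≤ t) (htu : t ≤ u) :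
    occupancy A s t + occupancy A t u = occupancy A s u := by
  have h := measureReal_inter_add_sdiff (μ := volume) (s := A ∩ Set.Ico s u)
    (measurableSet_Iio : MeasurableSet (Set.Iio t)) (volume_inter_Ico_ne_top A s u)
  have h1 : A ∩ Set.Ico s u ∩ Set.Iio t = A ∩ Set.Ico s t := by
    ext x
    simp only [Set.mem_inter_iff, Set.mem_Ico, Set.mem_Iio]
    grind
  have h2 : (A ∩ Set.Ico s u) \ Set.Iio t = A ∩ Set.Ico t u := by
    ext x
    simp only [Set.mem_inter_iff, Set.mem_Ico, Set.mem_Iio, Set.mem_sdiff]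
    grind
  rwa [h1, h2] at h

lemma continuous_occupancy (A : Set ℝ) (s : ℝ) : Continuous (occupancy A s) := by
  refine (LipschitzWith.of_le_add fun x y => ?_).continuous
  rcases le_total x y with h | h
  · exact (occupancy_mono_right A s h).trans (le_add_of_nonneg_right dist_nonneg)
  · rw [Real.dist_eq, abs_of_nonneg (sub_nonneg.2 h)]
    have hsub : A ∩ Set.Ico s x ⊆ (A ∩ Set.Ico s y) ∪ Set.Ico y x := by
      intro z hz
      simp only [Set.mem_inter_iff, Set.mem_Ico, Set.mem_union] at hz ⊢
      grind
    have := (measureReal_mono (μ := volume) hsub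
      (measure_union_ne_top (volume_inter_Ico_ne_top A s y) (by simp))).trans
      (measureReal_union_le _ _)
    rwa [Real.volume_real_Ico_of_le h] at this

/-! ### Job arrivals, service and interference. -/

section

variable {M N : ℕ} {τ : Fin N → Task}

/-- The instants at which some job of task `i` is executed. -/
def taskExecutionSet (S : Assignment M N) (i : Fin N) : Set ℝ := ⋃ j, executionSet S i j

lemma mem_taskExecutionSet {S : Assignment M N} {i : Fin N} {t : ℝ} :
    t ∈ taskExecutionSet S i ↔ ∃ p j, S p t = some (i, j) := by
  simp only [taskExecutionSet, executionSet, Set.mem_iUnion, Set.mem_ofPred_eq]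
  exact exists_comm

lemma service_eq_occupancy (ω : JobSequence τ) (S : Assignment M N) (i : Fin N) (j : ℕ) (t : ℝ) :
    service ω S i j t = occupancy (executionSet S i j) (ω.arrival i j) t := rfl

lemma service_mono (ω : JobSequence τ) (S : Assignment M N) (i : Fin N) (j : ℕ) :
    Monotone (service ω S i j) := occupancy_mono_right _ _

lemma JobSequence.arrival_add_mul_le (ω : JobSequence τ) (i : Fin N) (j n : ℕ) :
    ω.arrival i j + n * (τ i).T ≤ ω.arrival i (j + n) := by
  induction n with
  | zero => simp
  | succ n ih =>
    have := ω.arrival_add_period_le i (j + n)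
    rw [← add_assoc]
    push_cast
    linarith

lemma JobSequence.arrival_strictMono (ω : JobSequence τ) {i : Fin N} (hT : 0 < (τ i).T) :
    StrictMono (ω.arrival i) :=
  strictMono_nat_of_lt_succ fun j => by linarith [ω.arrival_add_period_le i j]

lemma JobSequence.finite_arrival_le (ω : JobSequence τ) {i : Fin N} (hT : 0 < (τ i).T) (t : ℝ) :
    {j | ω.arrival i j ≤ t}.Finite := by
  obtain ⟨n, hn⟩ := exists_nat_gt ((t - ω.arrival i 0) / (τ i).T)
  refine (Set.finite_Iio n).subset fun j hj => ?_
  by_contra! h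
  rw [Set.mem_Iio, not_lt] at h
  have h1 := ω.arrival_add_mul_le i 0 n
  rw [zero_add] at h1
  have h2 := (ω.arrival_strictMono hT).monotone h
  rw [div_lt_iff₀ hT] at hn
  have h3 : ω.arrival i j ≤ t := hj
  linarith

namespace IsGlobalFPSchedule

variable {ω : JobSequence τ} {S : Assignment M N}

lemma measurableSet_taskExecutionSet (h : IsGlobalFPSchedule ω S) (i : Fin N) :
    MeasurableSet (taskExecutionSet S i) :=
  MeasurableSet.iUnion fun j => h.measurableSet_executionSet i j

/-- A job never receives more execution than it needs. -/
lemma service_le_exec (h : IsGlobalFPSchedule ω S) (i : Fin N) (j : ℕ) (t : ℝ) :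
    service ω S i j t ≤ ω.exec i j := by
  by_contra! hlt
  have hat : ω.arrival i j ≤ t := by
    by_contra! hta
    have : service ω S i j t = 0 := by
      simp [service, Set.Ico_eq_empty_of_le hta.le]
    linarith [ω.exec_nonneg i j]
  -- By continuity, service equals the demand at some `s`; from then on the job is not pending and
  -- receives nothing.
  obtain ⟨s, ⟨has, hst⟩, hs⟩ : ω.exec i j ∈ service ω S i j '' Set.Icc (ω.arrival i j) t :=
    intermediate_value_Icc hat (continuous_occupancy _ _).continuousOn
      ⟨(occupancy_self _ _).trans_le (ω.exec_nonneg i j), hlt.le⟩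
  have hadd := occupancy_add (executionSet S i j) has hst
  have hzero : executionSet S i j ∩ Set.Ico s t = ∅ := by
    refine Set.eq_empty_of_forall_notMem ?_
    rintro x ⟨⟨p, hp⟩, hsx, -⟩
    have := (h.pending p x i j hp).2
    linarith [service_mono ω S i j hsx]
  have h0 : occupancy (executionSet S i j) s t = 0 := by simp [occupancy, hzero]
  rw [← service_eq_occupancy, ← service_eq_occupancy] at hadd
  linarith

/-- While task `i` is active but not executed, `M` tasks of higher priority are executed. -/
lemma card_le_of_active (h : IsGlobalFPSchedule ω S) {i : Fin N} {t : ℝ} (ha : Active ω S i t)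
    (ht : t ∉ taskExecutionSet S i) :
    (M : ℝ) ≤ ∑ i' ∈ Finset.Iio i, (taskExecutionSet S i').indicator (1 : ℝ → ℝ) t := by
  classical
  have hp := h.priority i t ha fun p j hpj => ht (mem_taskExecutionSet.2 ⟨p, j, hpj⟩)
  choose f hf g hg using hp
  have hinj : Function.Injective f := fun p q hpq =>
    h.sequential p q t (f p) (g p) (g q) (hg p) (hpq ▸ hg q)
  calc (M : ℝ) = ∑ i' ∈ Finset.univ.image f,
        (taskExecutionSet S i').indicator (1 : ℝ → ℝ) t := by
        rw [Finset.sum_image hinj.injOn]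
        have : ∀ p, (taskExecutionSet S (f p)).indicator (1 : ℝ → ℝ) t = 1 := fun p => by
          rw [Set.indicator_of_mem (mem_taskExecutionSet.2 ⟨p, g p, hg p⟩)]; rfl
        simp [this]
    _ ≤ _ := by
        refine Finset.sum_le_sum_of_subset_of_nonneg ?_ fun _ _ _ =>
          Set.indicator_nonneg (fun _ _ => zero_le_one) _
        intro x hx
        obtain ⟨p, -, rfl⟩ := Finset.mem_image.1 hx
        exact Finset.mem_Iio.2 (hf p)

/-- The interference suffered by a task that is active throughout `[s, t)`. -/
lemma interference_le (h : IsGlobalFPSchedule ω S) {i : Fin N} {s t : ℝ} (hst : s ≤ t)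
    (ha : ∀ x ∈ Set.Ico s t, Active ω S i x) :
    M * ((t - s) - occupancy (taskExecutionSet S i) s t)
      ≤ ∑ i' ∈ Finset.Iio i, occupancy (taskExecutionSet S i') s t := by
  have hocc : ∀ i', occupancy (taskExecutionSet S i') s t =
      ∫ x in Set.Ico s t, (taskExecutionSet S i').indicator (1 : ℝ → ℝ) x := fun i' => by
    rw [integral_indicator_one (h.measurableSet_taskExecutionSet i'),
      measureReal_restrict_apply (h.measurableSet_taskExecutionSet i')]
    rfl
  have hint : ∀ i', IntegrableOn ((taskExecutionSet S i').indicator (1 : ℝ → ℝ))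
      (Set.Ico s t) := fun i' =>
    IntegrableOn.indicator (integrableOn_const (by simp)) (h.measurableSet_taskExecutionSet i')
  have hone : IntegrableOn (fun _ => (1 : ℝ)) (Set.Ico s t) := integrableOn_const (by simp)
  have hlen : t - s = ∫ _ in Set.Ico s t, (1 : ℝ) := by
    simp [Real.volume_real_Ico_of_le hst]
  simp only [hocc]
  rw [← integral_finsetSum _ fun i' _ => hint i', hlen, ← integral_sub hone (hint i),
    ← integral_const_mul]
  refine setIntegral_mono_on ((hone.sub (hint i)).const_mul _)
    (integrable_finsetSum _ fun i' _ => hint i') measurableSet_Ico fun x hx => ?_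
  by_cases hxi : x ∈ taskExecutionSet S i
  · simp only [Set.indicator_of_mem hxi, Pi.one_apply, sub_self, mul_zero]
    exact Finset.sum_nonneg fun _ _ => Set.indicator_nonneg (fun _ _ => zero_le_one) _
  · simpa only [Set.indicator_of_notMem hxi, sub_zero, mul_one] using
      h.card_le_of_active (ha x hx) hxi

end IsGlobalFPSchedule

/-! ### Busy intervals and request bounds. -/

/-- All jobs of task `i` that arrived before `b` are finished at `b`. -/
def NoCarryIn (ω : JobSequence τ) (S : Assignment M N) (i : Fin N) (b : ℝ) : Prop :=
  ∀ j, ω.arrival i j < b → ω.exec i j ≤ service ω S i j b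

/-- The beginning of the maximal interval ending at `t` in which task `i` is active. -/
lemma exists_busy_start (ω : JobSequence τ) (S : Assignment M N) (i : Fin N)
    (hT : 0 < (τ i).T) (t : ℝ) :
    ∃ b ≤ t, (∀ x ∈ Set.Ico b t, Active ω S i x) ∧ NoCarryIn ω S i b ∧
      (b = t ∨ ∃ j, b = ω.arrival i j) := by
  classical
  by_cases hex : ∃ m, ω.arrival i m < t ∧ ∀ x ∈ Set.Ico (ω.arrival i m) t, Active ω S i x
  -- Take the least such job: an earlier one unfinished at its arrival would extend the busy
  -- interval and contradict minimality.
  · obtain ⟨hlt, hact⟩ := Nat.find_spec hex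
    refine ⟨_, hlt.le, hact, fun j hj => ?_, Or.inr ⟨_, rfl⟩⟩
    by_contra! hpend
    refine Nat.find_min hex ((ω.arrival_strictMono hT).lt_iff_lt.1 hj)
      ⟨hj.trans hlt, fun x hx => ?_⟩
    rcases lt_or_ge x (ω.arrival i (Nat.find hex)) with hxm | hxm
    · exact ⟨j, hx.1, (service_mono ω S i j hxm.le).trans_lt hpend⟩
    · exact hact x ⟨hxm, hx.2⟩
  · refine ⟨t, le_rfl, by simp, fun j hj => ?_, Or.inl rfl⟩
    by_contra! hpend
    exact hex ⟨j, hj, fun x hx => ⟨j, hx.1, (service_mono ω S i j hx.2.le).trans_lt hpend⟩⟩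

namespace IsGlobalFPSchedule

variable {ω : JobSequence τ} {S : Assignment M N}

/-- Without carry-in at `b`, only jobs that arrive at or after `b` execute from then on. -/
lemma le_arrival_of_noCarryIn (h : IsGlobalFPSchedule ω S) {i : Fin N} {b x : ℝ}
    (hb : NoCarryIn ω S i b) (hbx : b ≤ x) {j : ℕ} (hx : x ∈ executionSet S i j) :
    b ≤ ω.arrival i j := by
  obtain ⟨p, hp⟩ := hx
  by_contra! hlt
  have := (h.pending p x i j hp).2
  linarith [hb j hlt, service_mono ω S i j hbx]

lemma occupancy_le_sum_service (h : IsGlobalFPSchedule ω S) {i : Fin N} {b d : ℝ}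
    (J : Finset ℕ)
    (hJ : ∀ j, ∀ x ∈ Set.Ico b d, x ∈ executionSet S i j → j ∈ J) :
    occupancy (taskExecutionSet S i) b d ≤ ∑ j ∈ J, service ω S i j d := by
  have hsub : taskExecutionSet S i ∩ Set.Ico b d ⊆
      ⋃ j ∈ J, executionSet S i j ∩ Set.Ico (ω.arrival i j) d := by
    rintro x ⟨hx, hxI⟩
    obtain ⟨j, hj⟩ := Set.mem_iUnion.1 hx
    have ⟨p, hp⟩ := hj
    exact Set.mem_biUnion (hJ j x hxI hj) ⟨hj, (h.pending p x i j hp).1, hxI.2⟩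
  refine (measureReal_mono hsub ?_).trans (measureReal_biUnion_finset_le _ _)
  exact (measure_biUnion_lt_top J.finite_toSet fun j _ =>
    (volume_inter_Ico_ne_top _ _ _).lt_top).ne

/-- The execution of a task from an instant without carry-in is at most its linear request
bound. -/
lemma occupancy_le_of_noCarryIn (h : IsGlobalFPSchedule ω S) {i : Fin N}
    (hτ : (τ i).Admissible) {b d : ℝ} (hbd : b ≤ d) (hb : NoCarryIn ω S i b) :
    occupancy (taskExecutionSet S i) b d
      ≤ (τ i).U * (d - b) + ((τ i).C - (τ i).C * (τ i).U) := by
  classical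
  have hUT : (τ i).U * (τ i).T = (τ i).C := div_mul_cancel₀ _ hτ.T_pos.ne'
  have hU0 : 0 ≤ (τ i).U := div_nonneg hτ.C_pos.le hτ.T_pos.le
  have hfin : {j | b ≤ ω.arrival i j ∧ ω.arrival i j ≤ d}.Finite :=
    (ω.finite_arrival_le hτ.T_pos d).subset fun j hj => hj.2
  set J := hfin.toFinset with hJdef
  have hmem : ∀ j, j ∈ J ↔ b ≤ ω.arrival i j ∧ ω.arrival i j ≤ d := by simp [hJdef]
  have hocc := h.occupancy_le_sum_service (i := i) (b := b) (d := d) J fun j x hx hxj => by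
    obtain ⟨p, hp⟩ := hxj
    exact (hmem j).2 ⟨h.le_arrival_of_noCarryIn hb hx.1 ⟨p, hp⟩,
      (h.pending p x i j hp).1.trans hx.2.le⟩
  refine hocc.trans ?_
  rcases J.eq_empty_or_nonempty with hJ | hJ
  · rw [hJ, Finset.sum_empty]
    nlinarith [mul_nonneg hU0 (sub_nonneg.2 hbd), mul_nonneg hτ.C_pos.le
      (sub_nonneg.2 hτ.U_le_one)]
  · set m := J.min' hJ
    set p := J.max' hJ
    have hmp : m ≤ p := J.min'_le _ (J.max'_mem hJ)
    have hm := (hmem m).1 (J.min'_mem hJ)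
    have hp := (hmem p).1 (J.max'_mem hJ)
    have hsubs : J.erase p ⊆ Finset.Ico m p := fun j hj => by
      obtain ⟨hne, hj⟩ := Finset.mem_erase.1 hj
      exact Finset.mem_Ico.2 ⟨J.min'_le _ hj, lt_of_le_of_ne (J.le_max' _ hj) hne⟩
    have hs : ∀ j, service ω S i j d ≤ (τ i).C := fun j =>
      (h.service_le_exec i j d).trans (ω.exec_le i j)
    have hearly : ∑ j ∈ J.erase p, service ω S i j d ≤ (p - m : ℕ) * (τ i).C := by
      refine (Finset.sum_le_card_nsmul _ _ _ fun j _ => hs j).trans ?_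
      rw [nsmul_eq_mul]
      refine mul_le_mul_of_nonneg_right ?_ hτ.C_pos.le
      exact_mod_cast (Finset.card_le_card hsubs).trans_eq (Nat.card_Ico m p)
    have hlast : service ω S i p d ≤ d - ω.arrival i p := occupancy_le_sub _ hp.2
    have harr := ω.arrival_add_mul_le i m (p - m)
    rw [Nat.add_sub_cancel' hmp] at harr
    rw [← Finset.sum_erase_add J _ (J.max'_mem hJ)]
    set n : ℝ := ((p - m : ℕ) : ℝ)
    -- The last job's service is split with weights `U` and `1 - U`, bounded by the time since its
    -- arrival and by `C` respectively.
    have h1 : (τ i).U * (b + n * (τ i).T) ≤ (τ i).U * ω.arrival i p :=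
      mul_le_mul_of_nonneg_left (by linarith) hU0
    have h2 : (τ i).U * service ω S i p d ≤ (τ i).U * (d - ω.arrival i p) :=
      mul_le_mul_of_nonneg_left hlast hU0
    have h3 : (1 - (τ i).U) * service ω S i p d ≤ (1 - (τ i).U) * (τ i).C :=
      mul_le_mul_of_nonneg_left (hs p) (sub_nonneg.2 hτ.U_le_one)
    have h4 : (τ i).U * (n * (τ i).T) = n * (τ i).C := by rw [← hUT]; ring
    change ∑ j ∈ J.erase p, service ω S i j d + service ω S i p d ≤ _
    linarith

/-- If a job of task `k` misses its deadline `d`, then task `k` has a busy period `[a, d)` of length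
at least `(ℓ - 1) T_k + D_k` in which it executes for less than `ℓ C_k`. -/
lemma exists_busy_period_of_deadline_miss (h : IsGlobalFPSchedule ω S) {k : Fin N}
    (hτ : (τ k).Admissible) {j : ℕ}
    (hmiss : service ω S k j (ω.arrival k j + (τ k).D) < ω.exec k j) :
    ∃ (a d : ℝ) (ℓ : ℕ), 1 ≤ ℓ ∧ ((ℓ : ℝ) - 1) * (τ k).T + (τ k).D ≤ d - a ∧
      (∀ x ∈ Set.Ico a d, Active ω S k x) ∧
      occupancy (taskExecutionSet S k) a d < ℓ * (τ k).C := by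
  set d := ω.arrival k j + (τ k).D with hd
  have hjd : ω.arrival k j < d := by linarith [hτ.D_pos]
  obtain ⟨a, had, hact, hcarry, ha⟩ := exists_busy_start ω S k hτ.T_pos d
  have haj : a ≤ ω.arrival k j := by
    by_contra! hlt
    linarith [hcarry j hlt, service_mono ω S k j had]
  obtain ⟨m, rfl⟩ := ha.resolve_left (by linarith)
  have hmj : m ≤ j := (ω.arrival_strictMono hτ.T_pos).le_iff_le.1 haj
  -- `ℓ` counts the jobs `m, …, j`; by FIFO no later job runs before `d`, as `j` is still
  -- unfinished.
  refine ⟨ω.arrival k m, d, j - m + 1, by omega, ?_, hact, ?_⟩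
  · have := ω.arrival_add_mul_le k m (j - m)
    rw [Nat.add_sub_cancel' hmj] at this
    push_cast at this ⊢
    linarith
  · have hocc := h.occupancy_le_sum_service (i := k) (b := ω.arrival k m) (d := d)
      (Finset.Icc m j) fun j' x hx hxj => by
        refine Finset.mem_Icc.2 ⟨(ω.arrival_strictMono hτ.T_pos).le_iff_le.1
          (h.le_arrival_of_noCarryIn hcarry hx.1 hxj), ?_⟩
        obtain ⟨p, hp⟩ := hxj
        by_contra! hlt
        exact h.fifo p x k j' hp j hlt ⟨((ω.arrival_strictMono hτ.T_pos).monotone hlt.le).trans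
          (h.pending p x k j' hp).1, (service_mono ω S k j hx.2.le).trans_lt hmiss⟩
    refine hocc.trans_lt ?_
    have hlt : ∑ j' ∈ Finset.Icc m j, service ω S k j' d
        < ∑ _j' ∈ Finset.Icc m j, (τ k).C :=
      Finset.sum_lt_sum (fun j' _ => (h.service_le_exec k j' d).trans (ω.exec_le k j'))
        ⟨j, Finset.mem_Icc.2 ⟨hmj, le_rfl⟩, hmiss.trans_le (ω.exec_le k j)⟩
    rwa [Finset.sum_const, Nat.card_Icc, nsmul_eq_mul, Nat.sub_add_comm hmj] at hlt

end IsGlobalFPSchedule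

/-! ### Leftward extension of the window. -/

lemma U_le_Umax {i k : Fin N} (h : i < k) : (τ i).U ≤ Umax τ k :=
  (Finset.le_fold_max _).2 (Or.inr ⟨i, Finset.mem_Iio.2 h, le_rfl⟩)

lemma density_le_Umax (τ : Fin N → Task) (k : Fin N) : (τ k).density ≤ Umax τ k :=
  (Finset.le_fold_max _).2 (Or.inl le_rfl)

/-- Both `D` and `T` are at least `min D T`. This bounds the rate of task `k` in its busy period by
its density. -/
lemma Task.Admissible.mul_C_le_density_mul {τ : Task} (hτ : τ.Admissible) {ℓ : ℕ} (hℓ : 1 ≤ ℓ) :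
    ℓ * τ.C ≤ τ.density * (((ℓ : ℝ) - 1) * τ.T + τ.D) := by
  have hmin : 0 < min τ.D τ.T := lt_min hτ.D_pos hτ.T_pos
  have hℓ' : (0 : ℝ) ≤ (ℓ : ℝ) - 1 := sub_nonneg.2 (by exact_mod_cast hℓ)
  have hdens : 0 ≤ τ.density := div_nonneg hτ.C_pos.le hmin.le
  have hC : τ.density * min τ.D τ.T = τ.C := div_mul_cancel₀ _ hmin.ne'
  calc ℓ * τ.C = τ.density * (((ℓ : ℝ) - 1) * min τ.D τ.T + min τ.D τ.T) := by
        rw [← hC]; ring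
    _ ≤ _ := mul_le_mul_of_nonneg_left (add_le_add
        (mul_le_mul_of_nonneg_left (min_le_right _ _) hℓ') (min_le_left _ _)) hdens

lemma JobSequence.finite_setOf_arrival_le (ω : JobSequence τ) (hT : ∀ i, 0 < (τ i).T) (a : ℝ) :
    {x | x ≤ a ∧ ∃ i j, x = ω.arrival i j}.Finite := by
  refine (Set.finite_iUnion fun i =>
    (ω.finite_arrival_le (hT i) a).image (ω.arrival i)).subset ?_
  rintro x ⟨hx, i, j, rfl⟩
  exact Set.mem_iUnion.2 ⟨i, j, hx, rfl⟩

namespace IsGlobalFPSchedule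

variable {ω : JobSequence τ} {S : Assignment M N}

/-- If task `i < k` is active throughout `[b, t)` and the tasks of higher priority than `k` execute
at average rate at most `M - (M - 1) u` there, then task `i` executes at average rate at least `u`. -/
lemma rate_le_occupancy (h : IsGlobalFPSchedule ω S) (hM : 2 ≤ M) {i k : Fin N} (hik : i < k)
    {b t u : ℝ} (hbt : b ≤ t) (hact : ∀ x ∈ Set.Ico b t, Active ω S i x)
    (hload : ∑ i' ∈ Finset.Iio k, occupancy (taskExecutionSet S i') b t
      ≤ (M - (M - 1) * u) * (t - b)) :
    u * (t - b) ≤ occupancy (taskExecutionSet S i) b t := by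
  have hint := h.interference_le hbt hact
  have hsum : occupancy (taskExecutionSet S i) b t
      + ∑ i' ∈ Finset.Iio i, occupancy (taskExecutionSet S i') b t
      ≤ ∑ i' ∈ Finset.Iio k, occupancy (taskExecutionSet S i') b t := by
    rw [← Finset.sum_insert (f := fun i' => occupancy (taskExecutionSet S i') b t)
      (Finset.notMem_Iio_self (b := i))]
    refine Finset.sum_le_sum_of_subset_of_nonneg ?_ fun _ _ _ => occupancy_nonneg _ _ _
    intro x hx
    rcases Finset.mem_insert.1 hx with rfl | hx
    · exact Finset.mem_Iio.2 hik
    · exact Finset.mem_Iio.2 ((Finset.mem_Iio.1 hx).trans hik)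
  have hM1 : (0 : ℝ) < (M : ℝ) - 1 := by
    have : (2 : ℝ) ≤ M := by exact_mod_cast hM
    linarith
  -- Adding task `i`'s own work to its interference gives `M * (t - b) - (M - 1) * occ_i ≤ load`.
  refine le_of_mul_le_mul_left ?_ hM1
  linarith

/-- The window `[a, d)` extends to the left to a window `[t, d)` in which the execution of the
higher-priority tasks in excess of rate `M - (M - 1) U^max` is at least that in `[a, d)`, and in
which each of these tasks satisfies its linear request bound. -/
lemma exists_extended_window (h : IsGlobalFPSchedule ω S) (hM : 2 ≤ M)
    (hτ : ∀ i, (τ i).Admissible) (k : Fin N) {a d : ℝ} (had : a ≤ d) :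
    ∃ t ≤ a,
      ∑ i ∈ Finset.Iio k, occupancy (taskExecutionSet S i) a d
          - (M - (M - 1) * Umax τ k) * (d - a)
        ≤ ∑ i ∈ Finset.Iio k, occupancy (taskExecutionSet S i) t d
          - (M - (M - 1) * Umax τ k) * (d - t) ∧
      ∀ i < k, occupancy (taskExecutionSet S i) t d
        ≤ (τ i).U * (d - t) + ((τ i).C - (τ i).C * (τ i).U) := by
  set μ : ℝ := M - (M - 1) * Umax τ k with hμ
  -- Finitely many candidates suffice: the comparison point `b` below is either `t` itself or an
  -- arrival.
  obtain ⟨t, ht, hmax⟩ := Set.exists_max_image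
    (insert a {x | x ≤ a ∧ ∃ i j, x = ω.arrival i j})
    (fun x => ∑ i ∈ Finset.Iio k, occupancy (taskExecutionSet S i) x d - μ * (d - x))
    ((ω.finite_setOf_arrival_le (fun i => (hτ i).T_pos) a).insert a) ⟨a, Set.mem_insert _ _⟩
  have hta : t ≤ a := by
    rcases ht with rfl | ht
    · exact le_rfl
    · exact ht.1
  refine ⟨t, hta, hmax a (Set.mem_insert _ _), fun i hik => ?_⟩
  obtain ⟨b, hbt, hact, hcarry, hb⟩ := exists_busy_start ω S i (hτ i).T_pos t
  have hbmem : b ∈ insert a {x | x ≤ a ∧ ∃ i j, x = ω.arrival i j} := by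
    rcases hb with rfl | ⟨j, hj⟩
    · exact ht
    · exact Or.inr ⟨hbt.trans hta, i, j, hj⟩
  have hadd : ∀ i', occupancy (taskExecutionSet S i') b d =
      occupancy (taskExecutionSet S i') b t + occupancy (taskExecutionSet S i') t d := fun i' =>
    (occupancy_add _ hbt (hta.trans had)).symm
  have hle := hmax b hbmem
  simp only [hadd, Finset.sum_add_distrib] at hle
  have hrate := h.rate_le_occupancy hM hik (u := Umax τ k) hbt hact (by rw [← hμ]; linarith)
  have hU := mul_le_mul_of_nonneg_right (U_le_Umax (τ := τ) hik) (sub_nonneg.2 hbt)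
  have hreq := h.occupancy_le_of_noCarryIn (hτ i) (hbt.trans (hta.trans had)) hcarry
  rw [hadd i] at hreq
  linarith

end IsGlobalFPSchedule

end

end GlobalFP

/-! ### Contradiction with the schedulability test. -/

theorem theorem4p5 (M N : ℕ) (hM : 2 ≤ M) (τ : Fin N → GlobalFP.Task)
    (hτ : ∀ i, (τ i).Admissible) (k : Fin N)
    (htest : ∀ ℓ : ℕ, 1 ≤ ℓ →
      (ℓ : ℝ) * (τ k).C / (((ℓ : ℝ) - 1) * (τ k).T + (τ k).D)
        + ∑ i ∈ Finset.Iio k,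
            (((τ i).C - (τ i).C * (τ i).U) / (((ℓ : ℝ) - 1) * (τ k).T + (τ k).D) + (τ i).U)
        ≤ (M : ℝ) - ((M : ℝ) - 1) * GlobalFP.Umax τ k) :
    GlobalFP.Schedulable M τ k := by
  intro ω S h j
  by_contra! hmiss
  obtain ⟨a, d, ℓ, hℓ, hlen, hact, hX⟩ :=
    h.exists_busy_period_of_deadline_miss (hτ k) hmiss
  have hℓ' : (0 : ℝ) ≤ (ℓ : ℝ) - 1 := sub_nonneg.2 (by exact_mod_cast hℓ)
  have hDpos : 0 < ((ℓ : ℝ) - 1) * (τ k).T + (τ k).D :=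
    add_pos_of_nonneg_of_pos (mul_nonneg hℓ' (hτ k).T_pos.le) (hτ k).D_pos
  have had : a ≤ d := by linarith
  obtain ⟨t, hta, hload, hbound⟩ := h.exists_extended_window hM hτ k had
  have hint := h.interference_le had hact
  have htest' := htest ℓ hℓ
  set D' := ((ℓ : ℝ) - 1) * (τ k).T + (τ k).D with hD'
  set μ : ℝ := M - (M - 1) * GlobalFP.Umax τ k with hμ
  set X := GlobalFP.occupancy (GlobalFP.taskExecutionSet S k) a d
  have hM1 : (0 : ℝ) ≤ (M : ℝ) - 1 := by
    have : (2 : ℝ) ≤ M := by exact_mod_cast hM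
    linarith
  have hdens : 0 ≤ (τ k).density :=
    div_nonneg (hτ k).C_pos.le (le_min (hτ k).D_pos.le (hτ k).T_pos.le)
  have hXU : X ≤ GlobalFP.Umax τ k * (d - a) :=
    (hX.le.trans ((hτ k).mul_C_le_density_mul hℓ)).trans
      (mul_le_mul (GlobalFP.density_le_Umax τ k) hlen hDpos.le
        (hdens.trans (GlobalFP.density_le_Umax τ k)))
  have hsum : ∑ i ∈ Finset.Iio k, GlobalFP.occupancy (GlobalFP.taskExecutionSet S i) t d
      ≤ (∑ i ∈ Finset.Iio k, (τ i).U) * (d - t)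
        + ∑ i ∈ Finset.Iio k, ((τ i).C - (τ i).C * (τ i).U) := by
    rw [Finset.sum_mul, ← Finset.sum_add_distrib]
    exact Finset.sum_le_sum fun i hi => hbound i (Finset.mem_Iio.1 hi)
  have hXU' := mul_le_mul_of_nonneg_left hXU hM1
  have hwork : μ * (d - t) < (∑ i ∈ Finset.Iio k, (τ i).U) * (d - t)
      + (ℓ * (τ k).C + ∑ i ∈ Finset.Iio k, ((τ i).C - (τ i).C * (τ i).U)) := by
    have : μ * (d - a) = M * (d - a) - (M - 1) * (GlobalFP.Umax τ k * (d - a)) := by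
      rw [hμ]; ring
    linarith
  rw [Finset.sum_add_distrib, ← Finset.sum_div, ← add_assoc, ← add_div] at htest'
  have hB : 0 ≤ ℓ * (τ k).C + ∑ i ∈ Finset.Iio k, ((τ i).C - (τ i).C * (τ i).U) := by
    refine add_nonneg (mul_nonneg (Nat.cast_nonneg _) (hτ k).C_pos.le)
      (Finset.sum_nonneg fun i _ => ?_)
    linarith [mul_le_mul_of_nonneg_left (hτ i).U_le_one (hτ i).C_pos.le]
  set B := ℓ * (τ k).C + ∑ i ∈ Finset.Iio k, ((τ i).C - (τ i).C * (τ i).U)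
  have hDt : D' ≤ d - t := by linarith
  -- The constant terms only lose weight in a longer window, so the test at `D'` also covers length
  -- `d - t`.
  have hBD : B ≤ B / D' * (d - t) := by
    rw [div_mul_eq_mul_div, le_div_iff₀ hDpos]
    exact mul_le_mul_of_nonneg_left hDt hB
  have := mul_le_mul_of_nonneg_right htest' (hDpos.le.trans hDt)
  linarith
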